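/- Let $V$ and $W$ be time-oriented Lorentzian manifolds: smooth ($C^\infty$) finite-dimensional Hausdorff second countable manifolds without boundary, with smooth metrics $g$ on $V$ and $h$ on $W$ of signature $(-,+,\dots,+)$, each time-oriented by a smooth timelike vector field. A nonzero tangent vector is causal if it is timelike or null. Write $V\prec W$ if there is a smooth diffeomorphism $\varphi:V\to W$ whose differential maps every future-directed causal vector of $V$ to a future-directed causal vector of $W$. Timelike (causal) curves are piecewise $C^1$ curves on intervals all of whose (one-sided) velocities are timelike (causal) and future-directed; a past-directed curve is a future-directed curve traversed backwards. A curve $\gamma$ on an interval $J$ intersects a set $O$ more than once if $\{t\in J:\gamma(t)\in O\}$ is disconnected. A curve on a nonempty interval is inextendible if it has neither a future nor a past end point, i.e. it converges to no point of the manifold at either end of its interval. A time-oriented Lorentzian manifold $(M,g)$ satisfies 1. the chronology condition if it has no closed timelike curve; 2. the causality condition if it has no closed causal curve; 3. the future- (past-) distinguishing condition if for each $p\in M$ every neighbourhood of $p$ contains an open neighbourhood of $p$ which no future-directed (past-directed) causal curve starting at $p$ intersects more than once; 4. the strong causality condition if for each $p\in M$ every neighbourhood of $p$ contains an open neighbourhood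 of $p$ which no causal curve intersects more than once; 5. the stable causality condition if $g$ has a neighbourhood in the $C^0$ open (fine) topology, given by the metrics whose graph lies in some open set $U\supset g(M)$ of the bundle of bilinear forms on the tangent spaces, such that no smooth time-oriented Lorentzian metric in this neighbourhood has a closed timelike curve; 6. the global hyperbolicity condition if it has a Cauchy hypersurface, i.e. a subset $S\subset M$ which every inextendible timelike curve meets exactly once. Proposition. Suppose $V\prec W$. If $V$ violates the chronology condition, the causality condition, the future-distinguishing condition, the past-distinguishing condition, the strong causality condition, the stable causality condition or the global hyperbolicity condition, then $W$ violates the same condition. (Equivalently, each of these conditions passes from $W$ back to $V$.) -/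

import Mathlib

open Set Filter Topology Bundle
open scoped Manifold ContDiff

noncomputable section

namespace CausalLadder

/-- A smooth Lorentzian metric of signature `(-,+,…,+)` on a manifold modelled on `E`. -/
structure LorentzMetric (E : Type*) [NormedAddCommGroup E] [NormedSpace ℝ E]
    (M : Type*) [TopologicalSpace M] [ChartedSpace E M] [IsManifold 𝓘(ℝ, E) ∞ M] where
  /-- The value of the metric at each point. -/
  inner (x : M) : TangentSpace 𝓘(ℝ, E) x →L[ℝ] TangentSpace 𝓘(ℝ, E) x →L[ℝ] ℝ
  symm (x : M) (v w : TangentSpace 𝓘(ℝ, E) x) : inner x v w = inner x w v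
  /-- At each point there is a vector of negative square on whose orthogonal complement the form
  is positive definite, that is, the form is nondegenerate with exactly one negative direction. -/
  signature (x : M) : ∃ v : TangentSpace 𝓘(ℝ, E) x, inner x v v < 0 ∧
    ∀ w : TangentSpace 𝓘(ℝ, E) x, inner x v w = 0 → w ≠ 0 → 0 < inner x w w
  contMDiff : ContMDiff 𝓘(ℝ, E) (𝓘(ℝ, E).prod 𝓘(ℝ, E →L[ℝ] E →L[ℝ] ℝ)) ∞
    (fun x : M ↦ TotalSpace.mk' (E →L[ℝ] E →L[ℝ] ℝ)
      (E := fun x : M ↦ TangentSpace 𝓘(ℝ, E) x →L[ℝ] TangentSpace 𝓘(ℝ, E) x →L[ℝ] ℝ)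
      x (inner x))

/-- A time-oriented Lorentzian metric: the time orientation is given by a smooth timelike vector
field, declared to point to the future. -/
structure Spacetime (E : Type*) [NormedAddCommGroup E] [NormedSpace ℝ E]
    (M : Type*) [TopologicalSpace M] [ChartedSpace E M] [IsManifold 𝓘(ℝ, E) ∞ M]
    extends LorentzMetric E M where
  /-- The vector field which fixes the time orientation. -/
  clock (x : M) : TangentSpace 𝓘(ℝ, E) x
  clock_timelike (x : M) : inner x (clock x) (clock x) < 0
  clock_contMDiff : ContMDiff 𝓘(ℝ, E) 𝓘(ℝ, E).tangent ∞
    (fun x : M ↦ (⟨x, clock x⟩ : TangentBundle 𝓘(ℝ, E) M))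

section

variable {E : Type*} [NormedAddCommGroup E] [NormedSpace ℝ E]
  {M : Type*} [TopologicalSpace M] [ChartedSpace E M] [IsManifold 𝓘(ℝ, E) ∞ M]

namespace Spacetime

/-- Nonzero, timelike or null, future-directed vectors. -/
def futureCausal (g : Spacetime E M) (x : M) : Set (TangentSpace 𝓘(ℝ, E) x) :=
  {v | v ≠ 0 ∧ g.inner x v v ≤ 0 ∧ g.inner x (g.clock x) v < 0}

/-- Timelike future-directed vectors. -/
def futureTimelike (g : Spacetime E M) (x : M) : Set (TangentSpace 𝓘(ℝ, E) x) :=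
  {v | g.inner x v v < 0 ∧ g.inner x (g.clock x) v < 0}

end Spacetime

/-- `γ` restricted to `[a, b]`, `a < b`, is continuously differentiable (with one-sided derivatives
at the end points) and all its velocities belong to the given sets `C` of tangent vectors. -/
def IsArc (C : ∀ x : M, Set (TangentSpace 𝓘(ℝ, E) x)) (γ : ℝ → M) (a b : ℝ) : Prop :=
  a < b ∧ ContMDiffOn 𝓘(ℝ, ℝ) 𝓘(ℝ, E) 1 γ (Icc a b) ∧
    ∀ t ∈ Icc a b, mfderivWithin 𝓘(ℝ, ℝ) 𝓘(ℝ, E) γ (Icc a b) t 1 ∈ C (γ t)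

/-- `γ` is a piecewise continuously differentiable curve on the interval `J`, all of whose one-sided
velocities belong to `C`: every `t ∈ J` is the initial point of an arc inside `J` if it is not the
last point of `J`, and the final point of an arc inside `J` if it is not the first point of `J`.
(By compactness, each compact subinterval of `J` is then a finite union of arcs.) -/
def IsCurveOn (C : ∀ x : M, Set (TangentSpace 𝓘(ℝ, E) x)) (γ : ℝ → M) (J : Set ℝ) : Prop :=
  J.OrdConnected ∧
  (∀ t ∈ J, (∃ s ∈ J, t < s) → ∃ s ∈ J, IsArc C γ t s) ∧
  (∀ t ∈ J, (∃ s ∈ J, s < t) → ∃ s ∈ J, IsArc C γ s t)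

/-- A curve on the nonempty interval `J` is inextendible if it has neither a future end point nor a
past end point. -/
def IsInextendible (γ : ℝ → M) (J : Set ℝ) : Prop :=
  J.Nonempty ∧
  (¬ ∃ p : M, ∀ U ∈ 𝓝 p, ∃ t ∈ J, ∀ s ∈ J, t ≤ s → γ s ∈ U) ∧
  (¬ ∃ p : M, ∀ U ∈ 𝓝 p, ∃ t ∈ J, ∀ s ∈ J, s ≤ t → γ s ∈ U)

namespace Spacetime

/-- Chronology condition: there are no closed timelike curves. -/
def Chronological (g : Spacetime E M) : Prop :=
  ¬ ∃ (γ : ℝ → M) (a b : ℝ), a < b ∧ IsCurveOn g.futureTimelike γ (Icc a b) ∧ γ a = γ b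

/-- Causality condition: there are no closed causal curves. -/
def Causal (g : Spacetime E M) : Prop :=
  ¬ ∃ (γ : ℝ → M) (a b : ℝ), a < b ∧ IsCurveOn g.futureCausal γ (Icc a b) ∧ γ a = γ b

/-- Future-distinguishing condition: every neighbourhood of a point `p` contains an open
neighbourhood of `p` which no future-directed causal curve starting at `p` intersects more than
once, that is, in a disconnected set. -/
def FutureDistinguishing (g : Spacetime E M) : Prop :=
  ∀ p : M, ∀ U ∈ 𝓝 p, ∃ O ⊆ U, IsOpen O ∧ p ∈ O ∧
    ∀ (γ : ℝ → M) (a b : ℝ), a < b → IsCurveOn g.futureCausal γ (Icc a b) → γ a = p →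
      IsPreconnected {t | t ∈ Icc a b ∧ γ t ∈ O}

/-- Past-distinguishing condition: every neighbourhood of a point `p` contains an open
neighbourhood of `p` which no past-directed causal curve starting at `p` (that is, no
future-directed causal curve ending at `p`) intersects more than once. -/
def PastDistinguishing (g : Spacetime E M) : Prop :=
  ∀ p : M, ∀ U ∈ 𝓝 p, ∃ O ⊆ U, IsOpen O ∧ p ∈ O ∧
    ∀ (γ : ℝ → M) (a b : ℝ), a < b → IsCurveOn g.futureCausal γ (Icc a b) → γ b = p →
      IsPreconnected {t | t ∈ Icc a b ∧ γ t ∈ O}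

/-- Strong causality condition: every neighbourhood of a point `p` contains an open neighbourhood
of `p` which no causal curve intersects more than once. -/
def StronglyCausal (g : Spacetime E M) : Prop :=
  ∀ p : M, ∀ U ∈ 𝓝 p, ∃ O ⊆ U, IsOpen O ∧ p ∈ O ∧
    ∀ (γ : ℝ → M) (a b : ℝ), a < b → IsCurveOn g.futureCausal γ (Icc a b) →
      IsPreconnected {t | t ∈ Icc a b ∧ γ t ∈ O}

/-- Stable causality condition: the metric has a neighbourhood in the `C⁰` open (fine) topology such
that no metric in this neighbourhood has closed timelike curves. Basic neighbourhoods in this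
topology consist of the metrics whose graph lies in a fixed open subset of the bundle of bilinear
forms on the tangent spaces. -/
def StablyCausal (g : Spacetime E M) : Prop :=
  ∃ U : Set (TotalSpace (E →L[ℝ] E →L[ℝ] ℝ)
      (fun x : M ↦ TangentSpace 𝓘(ℝ, E) x →L[ℝ] TangentSpace 𝓘(ℝ, E) x →L[ℝ] ℝ)),
    IsOpen U ∧ (∀ x : M, ⟨x, g.inner x⟩ ∈ U) ∧
    ∀ g' : Spacetime E M, (∀ x : M, ⟨x, g'.inner x⟩ ∈ U) → g'.Chronological

/-- A Cauchy hypersurface: a set met exactly once by every inextendible timelike curve. (Such a set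
is automatically a closed topological hypersurface.) -/
def IsCauchyHypersurface (g : Spacetime E M) (S : Set M) : Prop :=
  ∀ (γ : ℝ → M) (J : Set ℝ), IsCurveOn g.futureTimelike γ J → IsInextendible γ J →
    ∃! t, t ∈ J ∧ γ t ∈ S

/-- Global hyperbolicity: there is a Cauchy hypersurface. -/
def GloballyHyperbolic (g : Spacetime E M) : Prop :=
  ∃ S : Set M, g.IsCauchyHypersurface S

end Spacetime

end

section

variable {E : Type*} [NormedAddCommGroup E] [NormedSpace ℝ E]
  {V : Type*} [TopologicalSpace V] [ChartedSpace E V] [IsManifold 𝓘(ℝ, E) ∞ V]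
  {F : Type*} [NormedAddCommGroup F] [NormedSpace ℝ F]
  {W : Type*} [TopologicalSpace W] [ChartedSpace F W] [IsManifold 𝓘(ℝ, F) ∞ W]

namespace Spacetime

/-- `V ≺_φ W`: the differential of the diffeomorphism `φ` maps future-directed causal vectors of `V`
to future-directed causal vectors of `W`. -/
def PrecBy (g : Spacetime E V) (φ : V ≃ₘ^∞⟮𝓘(ℝ, E), 𝓘(ℝ, F)⟯ W) (h : Spacetime F W) : Prop :=
  ∀ (x : V), ∀ u ∈ g.futureCausal x,
    mfderiv 𝓘(ℝ, E) 𝓘(ℝ, F) φ x u ∈ h.futureCausal (φ x)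

/-- `V ≺ W`: `W` is properly causally related with `V` by some diffeomorphism. -/
def Prec (g : Spacetime E V) (h : Spacetime F W) : Prop :=
  ∃ φ : V ≃ₘ^∞⟮𝓘(ℝ, E), 𝓘(ℝ, F)⟯ W, g.PrecBy φ h

end Spacetime

end

end CausalLadder

end

/-! Except for stable causality, each condition constrains curves and neighbourhoods, and `φ`
carries causal curves of `V` to causal curves of `W` with the same parameters. A closed curve, a
repeated entry into a set or an inextendible curve thus reappears in `W` (`IsCurveOn.map`,
`IsInextendible.map`). Timelike curves need `PrecBy.map_futureTimelike`: the differential is an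
isomorphism, so it sends the open timelike cone to an open subset of the closed cone, hence into its
interior.

For stable causality, let `U` be the neighbourhood of `h`. Subtracting a small positive multiple of
`τ ⊗ τ`, with `τ` dual to the clock, gives a metric `k` in `U` whose open cones contain the closed
cones of `h` without zero (`exists_widen_mem`, `widen_neg`). The forms on `V` whose closed cones
without zero are mapped into the open cones of `k` form a neighbourhood of `g`, by compactness of
the unit sphere. If `g'` is a metric in it, its clock pushed forward time-orients `k`, and a closed
timelike curve of `g'` would give one of `k`, which is impossible in `U`. -/

namespace CausalLadder

/-! ### Transport of curves -/

section Curves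

variable {E : Type*} [NormedAddCommGroup E] [NormedSpace ℝ E]
  {V : Type*} [TopologicalSpace V] [ChartedSpace E V]
  {F : Type*} [NormedAddCommGroup F] [NormedSpace ℝ F]
  {W : Type*} [TopologicalSpace W] [ChartedSpace F W]

theorem IsArc.map {C : ∀ x : V, Set (TangentSpace 𝓘(ℝ, E) x)}
    {D : ∀ x : W, Set (TangentSpace 𝓘(ℝ, F) x)} {f : V → W} (hf : ContMDiff 𝓘(ℝ, E) 𝓘(ℝ, F) ∞ f)
    (hCD : ∀ x, ∀ u ∈ C x, mfderiv 𝓘(ℝ, E) 𝓘(ℝ, F) f x u ∈ D (f x))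
    {γ : ℝ → V} {a b : ℝ} (hγ : IsArc C γ a b) : IsArc D (f ∘ γ) a b := by
  obtain ⟨hab, hsm, hC⟩ := hγ
  refine ⟨hab, (hf.of_le (by norm_cast)).comp_contMDiffOn hsm, fun t ht ↦ ?_⟩
  have hu : UniqueMDiffWithinAt 𝓘(ℝ, ℝ) (Icc a b) t :=
    (uniqueDiffOn_Icc hab t ht).uniqueMDiffWithinAt
  rw [mfderiv_comp_mfderivWithin t (hf.mdifferentiableAt (by simp))
    ((hsm t ht).mdifferentiableWithinAt (by simp)) hu]
  exact hCD _ _ (hC t ht)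

theorem IsCurveOn.map {C : ∀ x : V, Set (TangentSpace 𝓘(ℝ, E) x)}
    {D : ∀ x : W, Set (TangentSpace 𝓘(ℝ, F) x)} {f : V → W} (hf : ContMDiff 𝓘(ℝ, E) 𝓘(ℝ, F) ∞ f)
    (hCD : ∀ x, ∀ u ∈ C x, mfderiv 𝓘(ℝ, E) 𝓘(ℝ, F) f x u ∈ D (f x))
    {γ : ℝ → V} {J : Set ℝ} (hγ : IsCurveOn C γ J) : IsCurveOn D (f ∘ γ) J := by
  obtain ⟨hJ, h₁, h₂⟩ := hγ
  refine ⟨hJ, fun t ht hs ↦ ?_, fun t ht hs ↦ ?_⟩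
  · obtain ⟨s, hs, h⟩ := h₁ t ht hs
    exact ⟨s, hs, h.map hf hCD⟩
  · obtain ⟨s, hs, h⟩ := h₂ t ht hs
    exact ⟨s, hs, h.map hf hCD⟩

theorem IsInextendible.map {X Y : Type*} [TopologicalSpace X] [TopologicalSpace Y] (φ : X ≃ₜ Y)
    {γ : ℝ → X} {J : Set ℝ} (hγ : IsInextendible γ J) : IsInextendible (φ ∘ γ) J := by
  obtain ⟨hJ, h₁, h₂⟩ := hγ
  have key : ∀ {p : Y} {U : Set X}, U ∈ 𝓝 (φ.symm p) → φ.symm ⁻¹' U ∈ 𝓝 p :=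
    fun hU ↦ φ.symm.continuous.continuousAt.preimage_mem_nhds hU
  refine ⟨hJ, fun ⟨p, hp⟩ ↦ h₁ ⟨φ.symm p, fun U hU ↦ ?_⟩,
    fun ⟨p, hp⟩ ↦ h₂ ⟨φ.symm p, fun U hU ↦ ?_⟩⟩
  all_goals simpa using hp _ (key hU)

theorem Spacetime.Chronological.of_map [IsManifold 𝓘(ℝ, E) ∞ V] [IsManifold 𝓘(ℝ, F) ∞ W]
    {g : Spacetime E V} {h : Spacetime F W} {f : V → W}
    (hf : ContMDiff 𝓘(ℝ, E) 𝓘(ℝ, F) ∞ f)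
    (hgh : ∀ x, ∀ u ∈ g.futureTimelike x, mfderiv 𝓘(ℝ, E) 𝓘(ℝ, F) f x u ∈ h.futureTimelike (f x))
    (hh : h.Chronological) : g.Chronological :=
  fun ⟨γ, a, b, hab, hγ, he⟩ ↦ hh ⟨f ∘ γ, a, b, hab, hγ.map hf hgh, congrArg f he⟩

end Curves

/-! ### Linear algebra of Lorentzian cones -/

section Algebra

/-- In a form with exactly one negative direction, the orthogonal complement of every vector of
negative square is positive definite. -/
theorem pos_of_orthogonal_timelike {X : Type*} [AddCommGroup X] [Module ℝ X] [TopologicalSpace X]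
    {B : X →L[ℝ] X →L[ℝ] ℝ} (hB : ∀ v w, B v w = B w v)
    (hs : ∃ e, B e e < 0 ∧ ∀ w, B e w = 0 → w ≠ 0 → 0 < B w w)
    {c : X} (hc : B c c < 0) {w : X} (hcw : B c w = 0) (hw : w ≠ 0) : 0 < B w w := by
  obtain ⟨e, -, hpos⟩ := hs
  by_contra! hww
  -- `u` is the combination of `c` and `w` orthogonal to `e`. As `c ⊥ w`, its square is nonpositive,
  -- so `u = 0`; pairing with `c` gives `B e w = 0`, and then `w = 0`.
  set u := B e w • c - B e c • w with hu
  have hu0 : B e u = 0 := by simp [hu]; ring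
  have huu : B u u ≤ 0 := by
    have : B u u = (B e w) ^ 2 * B c c + (B e c) ^ 2 * B w w := by
      simp [hu, hcw, hB w c]; ring
    nlinarith [mul_nonneg (sq_nonneg (B e w)) (neg_nonneg.2 hc.le),
      mul_nonneg (sq_nonneg (B e c)) (neg_nonneg.2 hww)]
  have hu' : u = 0 := by
    by_contra h
    exact (hpos u hu0 h).not_ge huu
  have hc0 : c ≠ 0 := by rintro rfl; simp at hc
  have hec : B e c ≠ 0 := fun h ↦ (hpos c h hc0).not_gt hc
  have h1 : B e w * B c c = 0 := by
    have := congrArg (B c) hu'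
    simpa [hu, hcw] using this
  have h2 : B e w = 0 := (mul_eq_zero.1 h1).resolve_right hc.ne
  rw [hu, h2, zero_smul, zero_sub, neg_eq_zero] at hu'
  exact hw ((smul_eq_zero.1 hu').resolve_left hec)

/-- A linear injection maps vectors of negative square to vectors of negative square if it
maps them to vectors of nonpositive square in a form with exactly one negative direction. -/
theorem neg_of_neg_of_map {X Y : Type*} [NormedAddCommGroup X] [NormedSpace ℝ X]
    [NormedAddCommGroup Y] [NormedSpace ℝ Y] {B : X →L[ℝ] X →L[ℝ] ℝ} {B' : Y →L[ℝ] Y →L[ℝ] ℝ}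
    (hB' : ∀ v w, B' v w = B' w v)
    {L : X →L[ℝ] Y} (hL : Function.Surjective L) {c : Y}
    {u : X} (hcu : B' c (L u) ≠ 0) (hu : B u u < 0)
    (hmap : ∀ v, B v v < 0 → B' (L v) (L v) ≤ 0) : B' (L u) (L u) < 0 := by
  refine lt_of_le_of_ne (hmap u hu) fun h0 ↦ ?_
  -- If `L u` were null, moving `u` by `(t * a) • w` would change the square of its image by `2 * t
  -- * a ^ 2` to first order. This is positive for small `t > 0`, although the moved vector still
  -- has negative square.
  obtain ⟨w, rfl⟩ := hL c
  set a := B' (L w) (L u) with ha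
  have hcont : ContinuousAt (fun t : ℝ ↦ u + (t * a) • w) 0 := by fun_prop
  have h1 : ∀ᶠ v in 𝓝 u, B v v < 0 :=
    (show Continuous fun v ↦ B v v by fun_prop).continuousAt.eventually_lt continuousAt_const hu
  have h2 : ∀ᶠ t in 𝓝 (0 : ℝ), B' (L (u + (t * a) • w)) (L (u + (t * a) • w)) ≤ 0 := by
    rw [show u = u + ((0 : ℝ) * a) • w by simp] at h1
    filter_upwards [hcont.eventually h1] with t ht using hmap _ ht
  have h3 : ∀ᶠ t in 𝓝 (0 : ℝ), 0 < 2 + t * B' (L w) (L w) :=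
    continuousAt_const.eventually_lt
      (show Continuous fun t : ℝ ↦ 2 + t * B' (L w) (L w) by fun_prop).continuousAt (by simp)
  obtain ⟨t, ⟨h2, h3⟩, ht⟩ :=
    (((h2.and h3).filter_mono nhdsWithin_le_nhds).and
      (self_mem_nhdsWithin : Ioi (0 : ℝ) ∈ 𝓝[>] 0)).exists
  have ht : 0 < t := ht
  have : B' (L (u + (t * a) • w)) (L (u + (t * a) • w)) =
      (t * a ^ 2) * (2 + t * B' (L w) (L w)) := by
    simp [h0, hB' (L u) (L w), ← ha]; ring
  have : 0 < (t * a ^ 2) * (2 + t * B' (L w) (L w)) := mul_pos (mul_pos ht (sq_pos_iff.2 hcu)) h3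
  linarith

/-- If a linear map `L` maps vectors of negative square to vectors of negative square, then it maps
vectors in the same time cone to vectors in the same time cone. -/
theorem same_cone_of_map {X Y : Type*} [AddCommGroup X] [Module ℝ X] [TopologicalSpace X]
    [AddCommGroup Y] [Module ℝ Y] [TopologicalSpace Y]
    {B : X →L[ℝ] X →L[ℝ] ℝ} {B' : Y →L[ℝ] Y →L[ℝ] ℝ} (L : X →L[ℝ] Y)
    (hB : ∀ v w, B v w = B w v)
    (hs : ∀ c w, B' c c < 0 → B' c w = 0 → w ≠ 0 → 0 < B' w w)
    (hle : ∀ v, B v v < 0 → B' (L v) (L v) < 0) {c v : X} (hc : B c c < 0) (hv : B v v < 0)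
    (hcv : B c v < 0) : B' (L c) (L v) < 0 := by
  by_contra! h
  have hc' := hle c hc
  -- The coefficients make `L w` orthogonal to `L c`. Under the assumption `h` they are nonnegative,
  -- the second positive, so `w` stays in the cone of `c` and `v`; then `L w` would be timelike and
  -- orthogonal to a timelike vector.
  set w := (B' (L c) (L v)) • c + (-B' (L c) (L c)) • v with hw
  have hww : B w w < 0 := by
    have : B w w = (B' (L c) (L v)) ^ 2 * B c c
        + 2 * (B' (L c) (L v) * -B' (L c) (L c)) * B c v + (B' (L c) (L c)) ^ 2 * B v v := by
      simp [hw, hB v c]; ring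
    have h1 : 0 < (B' (L c) (L c)) ^ 2 := sq_pos_iff.2 hc'.ne
    have h2 : 0 ≤ B' (L c) (L v) * -B' (L c) (L c) := mul_nonneg h (by linarith)
    nlinarith [mul_nonneg (sq_nonneg (B' (L c) (L v))) (neg_nonneg.2 hc.le),
      mul_pos h1 (neg_pos.2 hv), mul_nonneg h2 (neg_nonneg.2 hcv.le)]
  have hw0 : L w ≠ 0 := by
    intro h
    simpa [h] using hle w hww
  exact (hs (L c) (L w) hc' (by simp [hw]; ring) hw0).not_gt (hle w hww)

end Algebra

/-! ### Continuity and openness in bundles of forms -/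

section Bundles

variable {F : Type*} [NormedAddCommGroup F] [NormedSpace ℝ F]
  {W : Type*} [TopologicalSpace W] [ChartedSpace F W] [IsManifold 𝓘(ℝ, F) ∞ W]

/-- The map `(t, y) ↦ σ y + t • τ y` into a vector bundle is continuous if the sections `σ`, `τ`
are. -/
theorem continuous_add_smul_section {B G : Type*} [TopologicalSpace B] [NormedAddCommGroup G]
    [NormedSpace ℝ G] {X : B → Type*} [TopologicalSpace (TotalSpace G X)]
    [∀ x, AddCommGroup (X x)] [∀ x, Module ℝ (X x)] [∀ x, TopologicalSpace (X x)]
    [FiberBundle G X] [VectorBundle ℝ G X] {σ τ : ∀ x, X x}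
    (hσ : Continuous fun x ↦ TotalSpace.mk' G x (σ x))
    (hτ : Continuous fun x ↦ TotalSpace.mk' G x (τ x)) :
    Continuous fun p : ℝ × B ↦ TotalSpace.mk' G p.2 (σ p.2 + p.1 • τ p.2) := by
  rw [continuous_iff_continuousAt]
  rintro ⟨t, y⟩
  have h1 := (FiberBundle.continuousAt_totalSpace G _).1 (hσ.continuousAt (x := y))
  have h2 := (FiberBundle.continuousAt_totalSpace G _).1 (hτ.continuousAt (x := y))
  rw [FiberBundle.continuousAt_totalSpace]
  refine ⟨continuousAt_snd, ?_⟩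
  have h3 : ContinuousAt (fun p : ℝ × B ↦
      (trivializationAt G X y (TotalSpace.mk' G p.2 (σ p.2))).2 +
        p.1 • (trivializationAt G X y (TotalSpace.mk' G p.2 (τ p.2))).2) (t, y) :=
    (h1.2.comp (x := (t, y)) continuousAt_snd).add
      (continuousAt_fst.smul (h2.2.comp (x := (t, y)) continuousAt_snd))
  refine h3.congr ?_
  have : ∀ᶠ p : ℝ × B in 𝓝 (t, y), p.2 ∈ (trivializationAt G X y).baseSet :=
    continuousAt_snd.eventually ((trivializationAt G X y).open_baseSet.mem_nhds
      (FiberBundle.mem_baseSet_trivializationAt' y))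
  filter_upwards [this] with p hp
  have hlin := Trivialization.linear ℝ (e := trivializationAt G X y) hp
  exact ((hlin.map_add _ _).trans (congrArg _ (hlin.map_smul _ _))).symm

/-- The square `τ ⊗ τ` of a smooth one-form is a smooth field of bilinear forms. -/
theorem contMDiff_smulRight_self {τ : ∀ x : W, TangentSpace 𝓘(ℝ, F) x →L[ℝ] ℝ}
    (hτ : ContMDiff 𝓘(ℝ, F) (𝓘(ℝ, F).prod 𝓘(ℝ, F →L[ℝ] ℝ)) ∞
      (fun x : W ↦ TotalSpace.mk' (F →L[ℝ] ℝ)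
        (E := fun x : W ↦ TangentSpace 𝓘(ℝ, F) x →L[ℝ] ℝ) x (τ x))) :
    ContMDiff 𝓘(ℝ, F) (𝓘(ℝ, F).prod 𝓘(ℝ, F →L[ℝ] F →L[ℝ] ℝ)) ∞
      (fun x : W ↦ TotalSpace.mk' (F →L[ℝ] F →L[ℝ] ℝ)
        (E := fun x : W ↦ TangentSpace 𝓘(ℝ, F) x →L[ℝ] TangentSpace 𝓘(ℝ, F) x →L[ℝ] ℝ)
        x ((τ x).smulRight (τ x))) := by
  intro x
  have h := contMDiffAt_totalSpace.1 (hτ x)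
  refine contMDiffAt_totalSpace.2 ⟨contMDiffAt_id, ?_⟩
  -- In a trivialization the square is one fixed quadratic map applied to the coordinates of `τ`.
  have hsq : ContDiff ℝ ∞ fun t : F →L[ℝ] ℝ ↦ t.smulRight t := contDiff_id.smulRight contDiff_id
  have h2 := hsq.contMDiff.contMDiffAt.comp x h.2
  refine h2.congr_of_eventuallyEq ?_
  filter_upwards [(trivializationAt (F →L[ℝ] ℝ)
    (fun x : W ↦ TangentSpace 𝓘(ℝ, F) x →L[ℝ] ℝ) x).open_baseSet.mem_nhds
      (FiberBundle.mem_baseSet_trivializationAt' x)] with y hy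
  ext v w
  simp [hom_trivializationAt_apply, ContinuousLinearMap.inCoordinates,
    Trivialization.coe_linearMapAt_of_mem _ hy]

theorem LorentzMetric.continuous_inner_self (h : LorentzMetric F W) :
    Continuous fun p : TangentBundle 𝓘(ℝ, F) W ↦ h.inner p.1 p.2 p.2 := by
  have hb : Continuous fun p : TangentBundle 𝓘(ℝ, F) W ↦
      TotalSpace.mk' (F →L[ℝ] F →L[ℝ] ℝ)
        (E := fun x : W ↦ TangentSpace 𝓘(ℝ, F) x →L[ℝ] TangentSpace 𝓘(ℝ, F) x →L[ℝ] ℝ)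
        p.1 (h.inner p.1) :=
    h.contMDiff.continuous.comp (FiberBundle.continuous_proj F (TangentSpace 𝓘(ℝ, F)))
  have : Continuous fun p : TangentBundle 𝓘(ℝ, F) W ↦
      TotalSpace.mk' ℝ (E := Bundle.Trivial W ℝ) p.1 (h.inner p.1 p.2 p.2) :=
    Continuous.clm_bundle_apply₂ (F₁ := F) (F₂ := F) hb continuous_id continuous_id
  exact (continuous_iff_continuousAt.2 fun p ↦
    ((FiberBundle.continuousAt_totalSpace _ _).1 this.continuousAt).2)

/-- For a continuous function `Q` on the tangent bundle which is homogeneous of degree two, the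
bilinear forms on the tangent spaces whose nonzero vectors of nonpositive square satisfy `Q < 0`
form an open set. -/
theorem isOpen_setOf_cone_subset [FiniteDimensional ℝ F] {Q : TangentBundle 𝓘(ℝ, F) W → ℝ}
    (hQ : Continuous Q)
    (hQ2 : ∀ (x : W) (a : ℝ) (v : TangentSpace 𝓘(ℝ, F) x), Q ⟨x, a • v⟩ = a ^ 2 * Q ⟨x, v⟩) :
    IsOpen {p : TotalSpace (F →L[ℝ] F →L[ℝ] ℝ)
      (fun x : W ↦ TangentSpace 𝓘(ℝ, F) x →L[ℝ] TangentSpace 𝓘(ℝ, F) x →L[ℝ] ℝ) |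
      ∀ v : TangentSpace 𝓘(ℝ, F) p.1, v ≠ 0 → p.2 v v ≤ 0 → Q ⟨p.1, v⟩ < 0} := by
  rw [isOpen_iff_mem_nhds]
  set Y := TotalSpace (F →L[ℝ] F →L[ℝ] ℝ)
      (fun x : W ↦ TangentSpace 𝓘(ℝ, F) x →L[ℝ] TangentSpace 𝓘(ℝ, F) x →L[ℝ] ℝ)
  intro p₀ hp₀
  set e := trivializationAt F (TangentSpace 𝓘(ℝ, F) : W → Type _) p₀.1
  have hx₀ : p₀.1 ∈ e.baseSet := FiberBundle.mem_baseSet_trivializationAt' p₀.1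
  have hproj : Continuous fun p : Y ↦ p.1 := FiberBundle.continuous_proj _ _
  have hbase : ∀ᶠ p : Y in 𝓝 p₀, p.1 ∈ e.baseSet :=
    hproj.continuousAt.eventually (e.open_baseSet.mem_nhds hx₀)
  have hσ : ∀ v : F, ContinuousAt (fun q : Y × F ↦
      (TotalSpace.mk' F q.1.1 (e.symmL ℝ q.1.1 q.2) : TangentBundle 𝓘(ℝ, F) W)) (p₀, v) := by
    intro v
    have h1 : ContinuousAt (fun q : Y × F ↦ e.toOpenPartialHomeomorph.symm (q.1.1, q.2)) (p₀, v) :=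
      ContinuousAt.comp (f := fun q : Y × F ↦ (q.1.1, q.2))
        (e.toOpenPartialHomeomorph.continuousAt_symm (e.mem_target.2 hx₀))
        ((hproj.comp continuous_fst).prodMk continuous_snd).continuousAt
    refine h1.congr ?_
    filter_upwards [continuousAt_fst.eventually hbase] with q hq
    rw [← e.mk_symm hq, e.symmL_apply hq]
  have hA : ∀ v : F, ContinuousAt (fun q : Y × F ↦
      q.1.2 (e.symmL ℝ q.1.1 q.2) (e.symmL ℝ q.1.1 q.2)) (p₀, v) := by
    intro v
    have : ContinuousAt (fun q : Y × F ↦ TotalSpace.mk' ℝ (E := Bundle.Trivial W ℝ) q.1.1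
        (q.1.2 (e.symmL ℝ q.1.1 q.2) (e.symmL ℝ q.1.1 q.2))) (p₀, v) :=
      ContinuousAt.clm_bundle_apply₂ (F₁ := F) (F₂ := F) continuousAt_fst (hσ v) (hσ v)
    exact ((FiberBundle.continuousAt_totalSpace _ _).1 this).2
  -- By homogeneity only unit vectors in a trivialization matter. Written as a disjunction of strict
  -- inequalities, the condition is open jointly in form and vector, so compactness of the sphere
  -- makes it uniform.
  have hK := (isCompact_sphere (0 : F) 1).eventually_forall_of_forall_eventually (x₀ := p₀)
    (P := fun (p : Y) (v : F) ↦ 0 < p.2 (e.symmL ℝ p.1 v) (e.symmL ℝ p.1 v) ∨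
      Q ⟨p.1, e.symmL ℝ p.1 v⟩ < 0) fun v hv ↦ by
    have hv0 : e.symmL ℝ p₀.1 v ≠ 0 := by
      intro h0
      have := e.continuousLinearMapAt_symmL (R := ℝ) hx₀ v
      rw [h0, map_zero] at this
      simp [← this] at hv
    rcases lt_or_ge 0 (p₀.2 (e.symmL ℝ p₀.1 v) (e.symmL ℝ p₀.1 v)) with h | h
    · filter_upwards [continuousAt_const.eventually_lt (hA v) h] with q hq using Or.inl hq
    · filter_upwards [(hQ.continuousAt.comp (hσ v)).eventually_lt continuousAt_const
        (hp₀ _ hv0 h)] with q hq using Or.inr hq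
  filter_upwards [hK, hbase] with p hp hpb v hv hvv
  set w : F := e.continuousLinearMapAt ℝ p.1 v with hw
  have hvw : e.symmL ℝ p.1 w = v := e.symmL_continuousLinearMapAt hpb v
  have hw0 : w ≠ 0 := by
    intro h0
    rw [h0, map_zero] at hvw
    exact hv hvw.symm
  have hn : 0 < (‖w‖⁻¹) ^ 2 := by have := norm_pos_iff.2 hw0; positivity
  have := hp (‖w‖⁻¹ • w) (by simp [norm_smul, hw0])
  rw [map_smul, hvw, hQ2] at this
  rcases this with h | h
  · have h' : p.2 (‖w‖⁻¹ • v) (‖w‖⁻¹ • v) = ‖w‖⁻¹ ^ 2 * p.2 v v := by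
      simp; ring
    rw [h'] at h
    exact absurd ((pos_iff_pos_of_mul_pos h).1 hn) hvv.not_gt
  · exact (pos_iff_neg_of_mul_neg h).1 hn

end Bundles

/-! ### Widening the light cones -/

section Widen

variable {F : Type*} [NormedAddCommGroup F] [NormedSpace ℝ F]
  {W : Type*} [TopologicalSpace W] [ChartedSpace F W] [IsManifold 𝓘(ℝ, F) ∞ W]

theorem LorentzMetric.pos_of_orthogonal (h : LorentzMetric F W) {x : W}
    {c w : TangentSpace 𝓘(ℝ, F) x} (hc : h.inner x c c < 0) (hcw : h.inner x c w = 0)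
    (hw : w ≠ 0) : 0 < h.inner x w w :=
  pos_of_orthogonal_timelike (h.symm x) (h.signature x) hc hcw hw

/-- Hence every nonzero nonspacelike vector is future- or past-directed. -/
theorem Spacetime.inner_clock_ne_zero (h : Spacetime F W) {x : W} {w : TangentSpace 𝓘(ℝ, F) x}
    (hw : w ≠ 0) (hww : h.inner x w w ≤ 0) : h.inner x (h.clock x) w ≠ 0 :=
  fun h0 ↦ (h.pos_of_orthogonal (h.clock_timelike x) h0 hw).not_ge hww

/-- The square of the one-form dual to the clock of a spacetime. -/
noncomputable def Spacetime.clockSq (h : Spacetime F W) (x : W) :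
    TangentSpace 𝓘(ℝ, F) x →L[ℝ] TangentSpace 𝓘(ℝ, F) x →L[ℝ] ℝ :=
  (h.inner x (h.clock x)).smulRight (h.inner x (h.clock x))

theorem Spacetime.clockSq_apply (h : Spacetime F W) (x : W) (v w : TangentSpace 𝓘(ℝ, F) x) :
    h.clockSq x v w = h.inner x (h.clock x) v * h.inner x (h.clock x) w := by
  simp [Spacetime.clockSq]

theorem Spacetime.contMDiff_clockSq (h : Spacetime F W) :
    ContMDiff 𝓘(ℝ, F) (𝓘(ℝ, F).prod 𝓘(ℝ, F →L[ℝ] F →L[ℝ] ℝ)) ∞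
      (fun x : W ↦ TotalSpace.mk' (F →L[ℝ] F →L[ℝ] ℝ)
        (E := fun x : W ↦ TangentSpace 𝓘(ℝ, F) x →L[ℝ] TangentSpace 𝓘(ℝ, F) x →L[ℝ] ℝ)
        x (h.clockSq x)) :=
  contMDiff_smulRight_self (h.contMDiff.clm_bundle_apply h.clock_contMDiff)

/-- The Lorentzian metric `h - f τ ⊗ τ`, where `τ` is dual to the clock of `h`. -/
noncomputable def Spacetime.widen (h : Spacetime F W) (f : W → ℝ)
    (hf : ContMDiff 𝓘(ℝ, F) 𝓘(ℝ, ℝ) ∞ f) (hf0 : ∀ x, 0 < f x) : LorentzMetric F W where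
  inner x := h.inner x - f x • h.clockSq x
  symm x v w := by simp [Spacetime.clockSq_apply, h.symm x v w, mul_comm]
  signature x := by
    have hc := h.clock_timelike x
    refine ⟨h.clock x, ?_, fun w hw hw0 ↦ ?_⟩
    · have : 0 ≤ f x * (h.inner x (h.clock x) (h.clock x) * h.inner x (h.clock x) (h.clock x)) :=
        mul_nonneg (hf0 x).le (mul_self_nonneg _)
      simp only [sub_apply, smul_apply,
        Spacetime.clockSq_apply, smul_eq_mul]
      linarith
    -- The second factor is positive, so both metrics have the same orthogonal complement of the
    -- clock, and they agree on it.
    · have h1 : h.inner x (h.clock x) w * (1 - f x * h.inner x (h.clock x) (h.clock x)) = 0 := by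
        simp only [sub_apply, smul_apply,
          Spacetime.clockSq_apply, smul_eq_mul] at hw
        linarith
      have h2 : 0 < 1 - f x * h.inner x (h.clock x) (h.clock x) := by
        nlinarith [hf0 x]
      have h3 := (mul_eq_zero.1 h1).resolve_right h2.ne'
      simpa [Spacetime.clockSq_apply, h3] using h.pos_of_orthogonal hc h3 hw0
  contMDiff := h.contMDiff.sub_section (hf.smul_section h.contMDiff_clockSq)

theorem Spacetime.widen_apply (h : Spacetime F W) {f : W → ℝ}
    (hf : ContMDiff 𝓘(ℝ, F) 𝓘(ℝ, ℝ) ∞ f) (hf0 : ∀ x, 0 < f x) (x : W)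
    (v w : TangentSpace 𝓘(ℝ, F) x) : (h.widen f hf hf0).inner x v w =
      h.inner x v w - f x * (h.inner x (h.clock x) v * h.inner x (h.clock x) w) := by
  simp [Spacetime.widen, Spacetime.clockSq_apply]

/-- The subtracted term is strictly positive because `τ` vanishes on no nonzero nonspacelike vector.
-/
theorem Spacetime.widen_neg (h : Spacetime F W) {f : W → ℝ}
    (hf : ContMDiff 𝓘(ℝ, F) 𝓘(ℝ, ℝ) ∞ f) (hf0 : ∀ x, 0 < f x) {x : W}
    {v : TangentSpace 𝓘(ℝ, F) x} (hv : v ≠ 0) (hvv : h.inner x v v ≤ 0) :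
    (h.widen f hf hf0).inner x v v < 0 := by
  rw [h.widen_apply]
  have := mul_pos (hf0 x) (mul_self_pos.2 (h.inner_clock_ne_zero hv hvv))
  linarith

theorem Spacetime.exists_widen_mem [FiniteDimensional ℝ F] [T2Space W] [SecondCountableTopology W]
    (h : Spacetime F W)
    {U : Set (TotalSpace (F →L[ℝ] F →L[ℝ] ℝ)
      (fun x : W ↦ TangentSpace 𝓘(ℝ, F) x →L[ℝ] TangentSpace 𝓘(ℝ, F) x →L[ℝ] ℝ))}
    (hU : IsOpen U) (hhU : ∀ x : W, ⟨x, h.inner x⟩ ∈ U) :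
    ∃ (f : W → ℝ) (hf : ContMDiff 𝓘(ℝ, F) 𝓘(ℝ, ℝ) ∞ f) (hf0 : ∀ x, 0 < f x),
      ∀ x, ⟨x, (h.widen f hf hf0).inner x⟩ ∈ U := by
  have : LocallyCompactSpace W := ChartedSpace.locallyCompactSpace F W
  -- Asking for the whole segment up to `r` makes `t x` an interval even if the fibres of `U` are
  -- not convex; local constants can then be glued by a smooth partition of unity.
  set t : W → Set ℝ := fun x ↦ {r | 0 < r ∧ ∀ s ∈ Icc 0 r,
    (⟨x, h.inner x + (-s) • h.clockSq x⟩ : TotalSpace (F →L[ℝ] F →L[ℝ] ℝ)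
      (fun x : W ↦ TangentSpace 𝓘(ℝ, F) x →L[ℝ] TangentSpace 𝓘(ℝ, F) x →L[ℝ] ℝ)) ∈ U}
  have hconv : ∀ x, Convex ℝ (t x) := fun x ↦ by
    refine OrdConnected.convex ⟨fun a ha b hb c hc ↦ ⟨ha.1.trans_le hc.1, fun s hs ↦ ?_⟩⟩
    exact hb.2 s ⟨hs.1, hs.2.trans hc.2⟩
  have hloc : ∀ x, ∃ c : ℝ, ∀ᶠ y in 𝓝 x, c ∈ t y := fun x ↦ by
    have hcont := (continuous_add_smul_section h.contMDiff.continuous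
      h.contMDiff_clockSq.continuous).comp
        ((continuous_neg.comp continuous_fst).prodMk continuous_snd : Continuous
          fun p : ℝ × W ↦ (-p.1, p.2))
    have hmem := hcont.continuousAt.preimage_mem_nhds (x := ((0 : ℝ), x))
      (hU.mem_nhds (by
        have h0 : h.inner x + (-0 : ℝ) • h.clockSq x = h.inner x := by ext; simp
        simpa only [Function.comp_apply, h0] using hhU x))
    rw [nhds_prod_eq] at hmem
    obtain ⟨A, hA, B, hB, hAB⟩ := Filter.mem_prod_iff.1 hmem
    obtain ⟨δ, hδ, hδA⟩ := Metric.mem_nhds_iff.1 hA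
    refine ⟨δ / 2, ?_⟩
    filter_upwards [hB] with y hy
    refine ⟨half_pos hδ, fun s hs ↦ ?_⟩
    have hsA : s ∈ A := hδA (by
      rw [mem_ball_zero_iff, Real.norm_of_nonneg hs.1]
      linarith [hs.2])
    exact hAB (mk_mem_prod hsA hy)
  obtain ⟨f, hf⟩ := exists_contMDiffMap_forall_mem_convex_of_local_const (n := ⊤) 𝓘(ℝ, F)
    hconv hloc
  refine ⟨f, f.contMDiff, fun x ↦ (hf x).1, fun x ↦ ?_⟩
  have := (hf x).2 (f x) ⟨(hf x).1.le, le_rfl⟩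
  have h0 : h.inner x + (-f x) • h.clockSq x = h.inner x - f x • h.clockSq x := by
    ext
    simp [sub_eq_add_neg]
  rwa [h0] at this

/-- A Lorentzian metric with a smooth timelike vector field, as a spacetime. -/
def LorentzMetric.withClock (h : LorentzMetric F W) (c : ∀ x : W, TangentSpace 𝓘(ℝ, F) x)
    (hc : ∀ x, h.inner x (c x) (c x) < 0)
    (hcs : ContMDiff 𝓘(ℝ, F) 𝓘(ℝ, F).tangent ∞
      (fun x : W ↦ (⟨x, c x⟩ : TangentBundle 𝓘(ℝ, F) W))) : Spacetime F W where
  toLorentzMetric := h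
  clock := c
  clock_timelike := hc
  clock_contMDiff := hcs

end Widen

/-! ### Cones and clocks under a diffeomorphism -/

section Diffeo

variable {E : Type*} [NormedAddCommGroup E] [NormedSpace ℝ E]
  {V : Type*} [TopologicalSpace V] [ChartedSpace E V]
  {F : Type*} [NormedAddCommGroup F] [NormedSpace ℝ F]
  {W : Type*} [TopologicalSpace W] [ChartedSpace F W]

theorem mfderiv_diffeomorph_bijective (φ : V ≃ₘ^∞⟮𝓘(ℝ, E), 𝓘(ℝ, F)⟯ W) (x : V) :
    Function.Bijective (mfderiv 𝓘(ℝ, E) 𝓘(ℝ, F) φ x) :=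
  (φ.mfderivToContinuousLinearEquiv (by simp) x).bijective

variable [IsManifold 𝓘(ℝ, E) ∞ V] [IsManifold 𝓘(ℝ, F) ∞ W]

/-- A smooth vector field can be pushed forward by a diffeomorphism. -/
theorem exists_contMDiff_pushforward (φ : V ≃ₘ^∞⟮𝓘(ℝ, E), 𝓘(ℝ, F)⟯ W)
    {c : ∀ x : V, TangentSpace 𝓘(ℝ, E) x}
    (hc : ContMDiff 𝓘(ℝ, E) 𝓘(ℝ, E).tangent ∞
      (fun x : V ↦ (⟨x, c x⟩ : TangentBundle 𝓘(ℝ, E) V))) :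
    ∃ c' : ∀ y : W, TangentSpace 𝓘(ℝ, F) y,
      ContMDiff 𝓘(ℝ, F) 𝓘(ℝ, F).tangent ∞
        (fun y : W ↦ (⟨y, c' y⟩ : TangentBundle 𝓘(ℝ, F) W)) ∧
      ∀ x, c' (φ x) = mfderiv 𝓘(ℝ, E) 𝓘(ℝ, F) φ x (c x) := by
  -- The tangent spaces at `φ (φ.symm y)` and `y` are both `F` by definition, so the ascription
  -- replaces a cast.
  refine ⟨fun y ↦ (mfderiv 𝓘(ℝ, E) 𝓘(ℝ, F) φ (φ.symm y) (c (φ.symm y)) : F), ?_, fun x ↦ ?_⟩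
  · have h1 : ContMDiff 𝓘(ℝ, F) 𝓘(ℝ, F).tangent ∞
        (fun y : W ↦ tangentMap 𝓘(ℝ, E) 𝓘(ℝ, F) φ ⟨φ.symm y, c (φ.symm y)⟩) :=
      (φ.contMDiff.contMDiff_tangentMap (m := ∞) (by simp)).comp (hc.comp φ.symm.contMDiff)
    convert h1 using 2 with y
    have : ∀ (z : W) (v : F), y = z → (⟨y, v⟩ : TangentBundle 𝓘(ℝ, F) W) = ⟨z, v⟩ := by
      rintro _ _ rfl; rfl
    exact this _ _ (φ.apply_symm_apply y).symm
  · have : ∀ x', x' = x → (mfderiv 𝓘(ℝ, E) 𝓘(ℝ, F) φ x' (c x') : F) =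
        (mfderiv 𝓘(ℝ, E) 𝓘(ℝ, F) φ x (c x) : F) := by
      rintro _ rfl; rfl
    exact this _ (φ.symm_apply_apply x)

namespace Spacetime

variable {g : Spacetime E V} {h : Spacetime F W} {φ : V ≃ₘ^∞⟮𝓘(ℝ, E), 𝓘(ℝ, F)⟯ W}

/-- Nonzero nonspacelike vectors, of either time orientation, are mapped to such vectors. -/
theorem PrecBy.inner_nonpos (hφ : g.PrecBy φ h) {x : V} {v : TangentSpace 𝓘(ℝ, E) x}
    (hv : v ≠ 0) (hvv : g.inner x v v ≤ 0) :
    h.inner (φ x) (mfderiv 𝓘(ℝ, E) 𝓘(ℝ, F) φ x v) (mfderiv 𝓘(ℝ, E) 𝓘(ℝ, F) φ x v) ≤ 0 := by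
  rcases (g.inner_clock_ne_zero hv hvv).lt_or_gt with h0 | h0
  · exact (hφ x v ⟨hv, hvv, h0⟩).2.1
  · simpa using (hφ x (-v) ⟨neg_ne_zero.2 hv, by simpa using hvv, by simpa using h0⟩).2.1

theorem PrecBy.map_futureTimelike (hφ : g.PrecBy φ h) (x : V) (u : TangentSpace 𝓘(ℝ, E) x)
    (hu : u ∈ g.futureTimelike x) :
    mfderiv 𝓘(ℝ, E) 𝓘(ℝ, F) φ x u ∈ h.futureTimelike (φ x) := by
  have ne : ∀ v, g.inner x v v < 0 → v ≠ 0 := by rintro _ hv rfl; simp at hv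
  have h1 := (hφ x u ⟨ne u hu.1, hu.1.le, hu.2⟩).2.2
  exact ⟨neg_of_neg_of_map (X := E) (Y := F) (h.symm (φ x)) (mfderiv_diffeomorph_bijective φ x).2
    h1.ne hu.1 fun v hv ↦ hφ.inner_nonpos (ne v hv) hv.le, h1⟩

end Spacetime

/-- The bilinear forms on `V` whose cones are mapped into the open cones of a metric on `W` form
an open set. -/
theorem LorentzMetric.isOpen_setOf_cone_subset [FiniteDimensional ℝ E] (k : LorentzMetric F W)
    {φ : V → W} (hφ : ContMDiff 𝓘(ℝ, E) 𝓘(ℝ, F) ∞ φ) :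
    IsOpen {p : TotalSpace (E →L[ℝ] E →L[ℝ] ℝ)
      (fun x : V ↦ TangentSpace 𝓘(ℝ, E) x →L[ℝ] TangentSpace 𝓘(ℝ, E) x →L[ℝ] ℝ) |
      ∀ v : TangentSpace 𝓘(ℝ, E) p.1, v ≠ 0 → p.2 v v ≤ 0 →
        k.inner (φ p.1) (mfderiv 𝓘(ℝ, E) 𝓘(ℝ, F) φ p.1 v) (mfderiv 𝓘(ℝ, E) 𝓘(ℝ, F) φ p.1 v) < 0} :=
  CausalLadder.isOpen_setOf_cone_subset
    (Q := fun p ↦ k.inner (φ p.1) (mfderiv 𝓘(ℝ, E) 𝓘(ℝ, F) φ p.1 p.2)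
      (mfderiv 𝓘(ℝ, E) 𝓘(ℝ, F) φ p.1 p.2))
    (k.continuous_inner_self.comp (hφ.continuous_tangentMap (by simp))) fun x a v ↦ by
      simp only [map_smul, smul_apply, smul_eq_mul]
      ring

/-- If the timelike vectors of `g` are mapped to timelike vectors of a metric `k`, and `k` is
chronological for all time orientations, then `g` is chronological. -/
theorem Spacetime.Chronological.of_forall_clock {g : Spacetime E V} {k : LorentzMetric F W}
    (φ : V ≃ₘ^∞⟮𝓘(ℝ, E), 𝓘(ℝ, F)⟯ W)
    (hlt : ∀ (x : V) (v : TangentSpace 𝓘(ℝ, E) x), g.inner x v v < 0 →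
      k.inner (φ x) (mfderiv 𝓘(ℝ, E) 𝓘(ℝ, F) φ x v) (mfderiv 𝓘(ℝ, E) 𝓘(ℝ, F) φ x v) < 0)
    (hk : ∀ k' : Spacetime F W, k'.toLorentzMetric = k → k'.Chronological) :
    g.Chronological := by
  -- `k` is oriented by the image of the clock of `g`, so that future-directed timelike vectors
  -- remain future-directed.
  obtain ⟨c, hcs, hc⟩ := exists_contMDiff_pushforward φ g.clock_contMDiff
  have hct : ∀ y, k.inner y (c y) (c y) < 0 := fun y ↦ by
    obtain ⟨x, rfl⟩ : ∃ x, φ x = y := φ.surjective y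
    rw [hc]
    exact hlt x _ (g.clock_timelike x)
  refine (hk (k.withClock c hct hcs) rfl).of_map φ.contMDiff fun x u hu ↦ ⟨hlt x u hu.1, ?_⟩
  change k.inner (φ x) (c (φ x)) _ < 0
  rw [hc]
  exact same_cone_of_map (X := E) (Y := F) (mfderiv 𝓘(ℝ, E) 𝓘(ℝ, F) φ x) (g.symm x)
    (fun v w hv hvw hw ↦ k.pos_of_orthogonal hv hvw hw) (hlt x) (g.clock_timelike x) hu.1 hu.2

theorem Spacetime.PrecBy.stablyCausal [FiniteDimensional ℝ E] [FiniteDimensional ℝ F] [T2Space W]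
    [SecondCountableTopology W] {g : Spacetime E V} {h : Spacetime F W}
    {φ : V ≃ₘ^∞⟮𝓘(ℝ, E), 𝓘(ℝ, F)⟯ W} (hφ : g.PrecBy φ h) (hh : h.StablyCausal) :
    g.StablyCausal := by
  obtain ⟨U, hU, hhU, hchr⟩ := hh
  obtain ⟨f, hf, hf0, hk⟩ := h.exists_widen_mem hU hhU
  refine ⟨_, (h.widen f hf hf0).isOpen_setOf_cone_subset φ.contMDiff, fun x v hv hvv ↦ ?_,
    fun g' hg' ↦ ?_⟩
  · refine h.widen_neg hf hf0 (fun h0 ↦ hv ?_) (hφ.inner_nonpos hv hvv)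
    exact (mfderiv_diffeomorph_bijective φ x).1 (h0.trans (map_zero _).symm)
  -- The clock of `g'` may be unrelated to those of `g` and `h`; membership in `U` depends on the
  -- metric alone, so any orientation of the widened metric is allowed.
  · exact .of_forall_clock φ (fun x v hv ↦ hg' x v (by rintro rfl; simp at hv) hv.le)
      fun k' hk' ↦ hchr k' (by rw [hk']; exact hk)

end Diffeo

end CausalLadder

/-! ### The seven conditions -/

theorem mainTheorem3
    {E : Type*} [NormedAddCommGroup E] [NormedSpace ℝ E] [FiniteDimensional ℝ E]
    {V : Type*} [TopologicalSpace V] [T2Space V] [SecondCountableTopology V]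
    [ChartedSpace E V] [IsManifold 𝓘(ℝ, E) ∞ V]
    {F : Type*} [NormedAddCommGroup F] [NormedSpace ℝ F] [FiniteDimensional ℝ F]
    {W : Type*} [TopologicalSpace W] [T2Space W] [SecondCountableTopology W]
    [ChartedSpace F W] [IsManifold 𝓘(ℝ, F) ∞ W]
    (g : CausalLadder.Spacetime E V) (h : CausalLadder.Spacetime F W) (hVW : g.Prec h) :
    (¬ g.Chronological → ¬ h.Chronological) ∧
    (¬ g.Causal → ¬ h.Causal) ∧
    (¬ g.FutureDistinguishing → ¬ h.FutureDistinguishing) ∧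
    (¬ g.PastDistinguishing → ¬ h.PastDistinguishing) ∧
    (¬ g.StronglyCausal → ¬ h.StronglyCausal) ∧
    (¬ g.StablyCausal → ¬ h.StablyCausal) ∧
    (¬ g.GloballyHyperbolic → ¬ h.GloballyHyperbolic) := by
  obtain ⟨φ, hφ⟩ := hVW
  have map {γ : ℝ → V} {J : Set ℝ} (hγ : CausalLadder.IsCurveOn g.futureCausal γ J) :
      CausalLadder.IsCurveOn h.futureCausal (φ ∘ γ) J := hγ.map φ.contMDiff hφ
  have nhds {p : V} {U : Set V} (hU : U ∈ 𝓝 p) : φ.symm ⁻¹' U ∈ 𝓝 (φ p) :=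
    φ.symm.continuous.continuousAt.preimage_mem_nhds (by simpa using hU)
  have sub {U : Set V} {O : Set W} (hO : O ⊆ φ.symm ⁻¹' U) : φ ⁻¹' O ⊆ U :=
    fun x hx ↦ by simpa using hO hx
  -- Sets in `W` are pulled back by `φ`: `γ` meets `φ ⁻¹' O` at exactly the parameters where `φ ∘ γ`
  -- meets `O`, so connectedness and unique intersection carry over verbatim.
  refine ⟨mt fun hh ↦ hh.of_map φ.contMDiff hφ.map_futureTimelike, mt ?_, mt ?_, mt ?_, mt ?_,
    mt hφ.stablyCausal, mt ?_⟩
  · rintro hh ⟨γ, a, b, hab, hγ, he⟩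
    exact hh ⟨φ ∘ γ, a, b, hab, map hγ, congrArg φ he⟩
  · intro hh p U hU
    obtain ⟨O, hOU, hO, hp, H⟩ := hh (φ p) _ (nhds hU)
    exact ⟨φ ⁻¹' O, sub hOU, hO.preimage φ.continuous, hp,
      fun γ a b hab hγ he ↦ H (φ ∘ γ) a b hab (map hγ) (congrArg φ he)⟩
  · intro hh p U hU
    obtain ⟨O, hOU, hO, hp, H⟩ := hh (φ p) _ (nhds hU)
    exact ⟨φ ⁻¹' O, sub hOU, hO.preimage φ.continuous, hp,
      fun γ a b hab hγ he ↦ H (φ ∘ γ) a b hab (map hγ) (congrArg φ he)⟩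
  · intro hh p U hU
    obtain ⟨O, hOU, hO, hp, H⟩ := hh (φ p) _ (nhds hU)
    exact ⟨φ ⁻¹' O, sub hOU, hO.preimage φ.continuous, hp,
      fun γ a b hab hγ ↦ H (φ ∘ γ) a b hab (map hγ)⟩
  · rintro ⟨S, hS⟩
    exact ⟨φ ⁻¹' S, fun γ J hγ hJ ↦
      hS (φ ∘ γ) J (hγ.map φ.contMDiff hφ.map_futureTimelike) (hJ.map φ.toHomeomorph)⟩
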